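/- By an $\mathbb R$-variety we mean a reduced separated scheme of finite type over $\operatorname{Spec}\mathbb R$. For an $\mathbb R$-variety $X$, let $X(\mathbb R)$ be the set of its $\mathbb R$-points, i.e. of sections $\operatorname{Spec}\mathbb R\to X$ of the structure morphism, each identified with its image point in $X$, and let the smooth locus $\operatorname{Sm}(X)$ be the set of all $x\in X$ such that the Krull dimension of the local ring $\mathcal O_{X,x}$ equals the dimension, over the residue field at $x$, of the Zariski tangent space $T_xX=(\mathfrak m_x/\mathfrak m_x^2)^*$. Let $X$ be an irreducible $\mathbb R$-variety and assume that some $\mathbb R$-point of $X$ lies in $\operatorname{Sm}(X)$. Then $X(\mathbb R)$ is Zariski dense in $X$, i.e. the closure of $X(\mathbb R)$ in the Zariski topology of $X$ is all of $X$. -/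

import Mathlib

open CategoryTheory AlgebraicGeometry

noncomputable section

namespace RealVariety

/-- A scheme `X` with structure morphism `p : X ⟶ Spec ℝ` is an `ℝ`-variety if it is reduced,
separated and of finite type over `Spec ℝ` (irreducibility is not part of the definition). -/
class IsRealVariety {X : Scheme.{0}} (p : X ⟶ Spec (CommRingCat.of ℝ)) : Prop where
  isReduced : IsReduced X
  isSeparated : IsSeparated p
  locallyOfFiniteType : LocallyOfFiniteType p
  quasiCompact : QuasiCompact p

/-- The `ℝ`-points of `X`: morphisms `Spec ℝ ⟶ X` over `Spec ℝ`. -/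
def RealPoint {X : Scheme.{0}} (p : X ⟶ Spec (CommRingCat.of ℝ)) : Type :=
  {f : Spec (CommRingCat.of ℝ) ⟶ X // f ≫ p = 𝟙 (Spec (CommRingCat.of ℝ))}

/-- The point of the topological space of `X` that is the image of an `ℝ`-point. -/
def RealPoint.pt {X : Scheme.{0}} {p : X ⟶ Spec (CommRingCat.of ℝ)} (f : RealPoint p) : X :=
  f.1 (IsLocalRing.closedPoint ℝ)

/-- For a subset `S` of `X`, the set `S(ℝ)` of `ℝ`-points of `X` lying in `S`, each identified
with its image in `X`. -/
def realPoints {X : Scheme.{0}} (p : X ⟶ Spec (CommRingCat.of ℝ)) (S : Set X) : Set X :=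
  {x | x ∈ S ∧ ∃ f : RealPoint p, f.pt = x}

/-- The Zariski closure of `X(ℝ)` in `X`. -/
def realClosure {X : Scheme.{0}} (p : X ⟶ Spec (CommRingCat.of ℝ)) : Set X :=
  closure (realPoints p Set.univ)

/-- The Zariski tangent space of `X` at `x`: the dual of `𝔪ₓ / 𝔪ₓ²` over the residue field
(which is `ℝ` when `x` is an `ℝ`-point). -/
abbrev TangentSpaceAt (X : Scheme.{0}) (x : X) : Type :=
  Module.Dual (IsLocalRing.ResidueField (X.presheaf.stalk x))
    (IsLocalRing.CotangentSpace (X.presheaf.stalk x))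

/-- The smooth locus `Sm(X)`: the points at which the Krull dimension of the local ring equals the
dimension of the tangent space. -/
def Sm (X : Scheme.{0}) : Set X :=
  {x | ringKrullDim (X.presheaf.stalk x) =
    Module.finrank (IsLocalRing.ResidueField (X.presheaf.stalk x)) (TangentSpaceAt X x)}

end RealVariety

end

/-! Work on an affine neighbourhood of the given real point, with coordinate ring a domain `A =
ℝ[x₁,…,xₙ]/I` and the point moved to the origin. Let `d` be the dimension of its local ring, which
is regular. Linear parts of elements of `I` span a space of codimension `e ≤ d`; lift a basis of it
to equations in `I` and complete by `e` linear forms to a coordinate system `F` at the origin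
(`exists_adapted_coordinates`).

Let `J` be the ideal generated by the equations locally at the origin. The inverse function theorem
parametrizes their real zeros by `u(z)`, with `z` small in `ℝᵉ`. A polynomial outside `J` has, along
`u`, a nonzero leading form in `z` (`exists_leading_form`, through Krull's intersection theorem).
Leading forms multiply, so `J` is prime (`isPrime_localIdeal`). Now `J ≤ I`, and a strict inclusion
would give `d + 1 ≤ e ≤ d` by comparing heights, so `I = J`. Any `f ∉ I` is then nonzero at some
`u(z)`, which is a real point of the variety (`exists_eval_ne_zero`). -/

noncomputable section

open MvPolynomial Topology Asymptotics Filter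

namespace MvPolynomial

/-! ### Constant and linear terms of polynomials at the origin -/

section LinearPart

variable {σ : Type*}

/-- The linear part of a polynomial, as a vector of coefficients. -/
def linearPart (σ : Type*) : MvPolynomial σ ℝ →ₗ[ℝ] (σ → ℝ) :=
  LinearMap.pi fun i => lcoeff ℝ (Finsupp.single i 1)

theorem linearPart_apply (p : MvPolynomial σ ℝ) (i : σ) :
    linearPart σ p i = coeff (Finsupp.single i 1) p := rfl

theorem linearPart_C (c : ℝ) : linearPart σ (C c) = 0 := by
  classical
  ext i
  simp [linearPart_apply, coeff_C, eq_comm]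

theorem linearPart_X [DecidableEq σ] (i : σ) : linearPart σ (X i) = Pi.single i 1 := by
  ext j
  simp [linearPart_apply, coeff_X, Pi.single_apply, Finsupp.single_left_inj, eq_comm]

theorem linearPart_mul (p q : MvPolynomial σ ℝ) :
    linearPart σ (p * q) =
      constantCoeff p • linearPart σ q + constantCoeff q • linearPart σ p := by
  classical
  ext i
  simp [linearPart_apply, coeff_mul, Finsupp.antidiagonal_single, constantCoeff_eq,
    Finset.Nat.antidiagonal_succ]
  ring

theorem mem_idealOfVars_iff (p : MvPolynomial σ ℝ) :
    p ∈ idealOfVars σ ℝ ↔ constantCoeff p = 0 := by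
  rw [← pow_one (idealOfVars σ ℝ), mem_pow_idealOfVars_iff']
  simp [constantCoeff_eq, Finsupp.degree_eq_zero_iff]

theorem mem_idealOfVars_sq_iff (p : MvPolynomial σ ℝ) :
    p ∈ idealOfVars σ ℝ ^ 2 ↔ constantCoeff p = 0 ∧ linearPart σ p = 0 := by
  rw [mem_pow_idealOfVars_iff']
  constructor
  · intro h
    refine ⟨by simpa [constantCoeff_eq] using h 0 (by simp), ?_⟩
    ext i
    exact h (Finsupp.single i 1) (by simp)
  · rintro ⟨h0, h1⟩ x hx
    obtain h | h : x.degree = 0 ∨ x.degree = 1 := by omega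
    · rw [Finsupp.degree_eq_zero_iff] at h
      simpa [h, constantCoeff_eq] using h0
    · obtain ⟨i, hi⟩ : x.support.Nonempty := by
        rw [Finsupp.support_nonempty_iff]
        rintro rfl
        simp at h
      obtain ⟨y, rfl⟩ := le_iff_exists_add.mp (show Finsupp.single i 1 ≤ x by
        simpa [Nat.one_le_iff_ne_zero] using hi)
      have hy : y = 0 := by simpa [Finsupp.degree_eq_zero_iff] using h
      rw [hy, add_zero]
      exact congrFun h1 i

end LinearPart

theorem IsHomogeneous.eval_smul {ι : Type*} {Q : MvPolynomial ι ℝ} {k : ℕ}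
    (hQ : Q.IsHomogeneous k) (t : ℝ) (v : ι → ℝ) : eval (t • v) Q = t ^ k * eval v Q := by
  rw [eval_eq, eval_eq, Finset.mul_sum]
  refine Finset.sum_congr rfl fun d hd => ?_
  have hk : ∑ i ∈ d.support, d i = k := by
    simpa [Finsupp.weight_apply, Finsupp.sum] using hQ (mem_support_iff.mp hd)
  simp only [Pi.smul_apply, smul_eq_mul, mul_pow, Finset.prod_mul_distrib,
    Finset.prod_pow_eq_pow_sum, hk]
  ring

/-! ### Expansion by order of vanishing, modulo the equations -/

section Order

variable {σ ι κ : Type*} [Fintype ι] [Fintype κ]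

/-- Expand the linear part of `p` in those of the `F j`: the `inl` terms form `L`, the `inr` terms
lie in the ideal, and what remains has no term of degree below 2. -/
theorem exists_linear_sub_mem (F : ι ⊕ κ → MvPolynomial σ ℝ)
    (hF : ∀ j, constantCoeff (F j) = 0)
    (hspan : ⊤ ≤ Submodule.span ℝ (Set.range fun j => linearPart σ (F j)))
    {p : MvPolynomial σ ℝ} (hp : p ∈ idealOfVars σ ℝ) :
    ∃ L : MvPolynomial ι ℝ, L.IsHomogeneous 1 ∧ p - aeval (F ∘ Sum.inl) L ∈
      Ideal.span (Set.range (F ∘ Sum.inr)) ⊔ idealOfVars σ ℝ ^ 2 := by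
  obtain ⟨c, hc⟩ := (Submodule.mem_span_range_iff_exists_fun ℝ).mp
    (hspan (Submodule.mem_top (x := linearPart σ p)))
  refine ⟨∑ i, C (c (Sum.inl i)) * X i, IsHomogeneous.sum _ _ _ fun i _ => ?_, ?_⟩
  · simpa using (isHomogeneous_C ι (c (Sum.inl i))).mul (isHomogeneous_X ℝ i)
  have hG : ∑ j, C (c (Sum.inr j)) * F (Sum.inr j) ∈ Ideal.span (Set.range (F ∘ Sum.inr)) :=
    Ideal.sum_mem _ fun j _ => Ideal.mul_mem_left _ _ (Ideal.subset_span ⟨j, rfl⟩)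
  have hsq : p - aeval (F ∘ Sum.inl) (∑ i, C (c (Sum.inl i)) * X i : MvPolynomial ι ℝ)
      - ∑ j, C (c (Sum.inr j)) * F (Sum.inr j) ∈ idealOfVars σ ℝ ^ 2 := by
    rw [mem_idealOfVars_sq_iff]
    constructor
    · simp [hF, (mem_idealOfVars_iff p).mp hp, algebraMap_eq]
    · simp [← hc, algebraMap_eq, linearPart_mul, linearPart_C, hF]
  simpa using add_mem (Ideal.mem_sup_right hsq) (Ideal.mem_sup_left hG)

theorem aeval_mem_idealOfVars_pow {σ ι : Type*} {y : ι → MvPolynomial σ ℝ} (hy : ∀ i, constantCoeff (y i) = 0)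
    {Q : MvPolynomial ι ℝ} {k : ℕ} (hQ : Q.IsHomogeneous k) :
    aeval y Q ∈ idealOfVars σ ℝ ^ k := by
  rw [aeval_eq_eval₂Hom, coe_eval₂Hom, eval₂_eq]
  refine Ideal.sum_mem _ fun d hd => Ideal.mul_mem_left _ _ ?_
  have hk : ∑ i ∈ d.support, d i = k := by
    simpa [Finsupp.weight_apply, Finsupp.sum] using hQ (mem_support_iff.mp hd)
  rw [← hk, ← Finset.prod_pow_eq_pow_sum]
  exact Ideal.prod_mem_prod fun i _ => Ideal.pow_mem_pow ((mem_idealOfVars_iff _).mpr (hy i)) _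

theorem exists_isHomogeneous_sub_mem (F : ι ⊕ κ → MvPolynomial σ ℝ)
    (hF : ∀ j, constantCoeff (F j) = 0)
    (hspan : ⊤ ≤ Submodule.span ℝ (Set.range fun j => linearPart σ (F j))) (k : ℕ)
    {p : MvPolynomial σ ℝ} (hp : p ∈ idealOfVars σ ℝ ^ k) :
    ∃ Q : MvPolynomial ι ℝ, Q.IsHomogeneous k ∧ p - aeval (F ∘ Sum.inl) Q ∈
      Ideal.span (Set.range (F ∘ Sum.inr)) ⊔ idealOfVars σ ℝ ^ (k + 1) := by
  induction k generalizing p with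
  | zero =>
    refine ⟨C (constantCoeff p), isHomogeneous_C _ _, Ideal.mem_sup_right ?_⟩
    simp [mem_idealOfVars_iff, algebraMap_eq]
  | succ k ih =>
    rw [pow_succ] at hp
    refine Submodule.mul_induction_on hp (fun a ha x hx => ?_) fun a b => ?_
    · obtain ⟨Q, hQ, haQ⟩ := ih ha
      obtain ⟨L, hL, hxL⟩ := exists_linear_sub_mem F hF hspan hx
      refine ⟨Q * L, hQ.mul hL, ?_⟩
      -- With `Q` and `L` read in the coordinates `F ∘ Sum.inl`, `a x - Q L = (a - Q) x + Q (x -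
      -- L)`.
      have h1 : (a - aeval (F ∘ Sum.inl) Q) * x ∈
          Ideal.span (Set.range (F ∘ Sum.inr)) ⊔ idealOfVars σ ℝ ^ (k + 1 + 1) := by
        have h := Ideal.mul_mem_mul haQ hx
        rw [Ideal.sup_mul, ← pow_succ] at h
        have hle := sup_le_sup_right (Ideal.mul_le_left (I := Ideal.span (Set.range (F ∘ Sum.inr)))
          (J := idealOfVars σ ℝ)) (idealOfVars σ ℝ ^ (k + 1 + 1))
        exact hle h
      have h2 : aeval (F ∘ Sum.inl) Q * (x - aeval (F ∘ Sum.inl) L) ∈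
          Ideal.span (Set.range (F ∘ Sum.inr)) ⊔ idealOfVars σ ℝ ^ (k + 1 + 1) := by
        have h := Ideal.mul_mem_mul
          (aeval_mem_idealOfVars_pow (fun i => hF (Sum.inl i)) hQ) hxL
        rw [Ideal.mul_sup, ← pow_add] at h
        have hle := sup_le_sup_right (Ideal.mul_le_right (I := idealOfVars σ ℝ ^ k)
          (J := Ideal.span (Set.range (F ∘ Sum.inr)))) (idealOfVars σ ℝ ^ (k + 1 + 1))
        exact hle h
      have h := add_mem h1 h2
      convert h using 1
      rw [map_mul]
      ring
    · rintro ⟨Q, hQ, ha⟩ ⟨Q', hQ', hb⟩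
      refine ⟨Q + Q', hQ.add hQ', ?_⟩
      convert add_mem ha hb using 1
      rw [map_add]
      ring

/-- The ideal of polynomials that lie in `G` locally at the origin. -/
def localIdeal {σ : Type*} (G : Ideal (MvPolynomial σ ℝ)) : Ideal (MvPolynomial σ ℝ) where
  carrier := {f | ∃ h, constantCoeff h ≠ 0 ∧ h * f ∈ G}
  zero_mem' := ⟨1, by simp, by simp⟩
  add_mem' := by
    rintro a b ⟨h, hh, ha⟩ ⟨l, hl, hb⟩
    refine ⟨h * l, by simp [hh, hl], ?_⟩
    convert add_mem (G.mul_mem_left l ha) (G.mul_mem_left h hb) using 1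
    ring
  smul_mem' := by
    rintro c a ⟨h, hh, ha⟩
    refine ⟨h, hh, ?_⟩
    convert G.mul_mem_left c ha using 1
    rw [smul_eq_mul]
    ring

theorem le_localIdeal (G : Ideal (MvPolynomial σ ℝ)) : G ≤ localIdeal G :=
  fun f hf => ⟨1, by simp, by simpa using hf⟩

/-- Krull's intersection theorem in the quotient by `G`: the class of `f` is killed by some `1 - r`
with `r` vanishing at the origin. -/
theorem mem_localIdeal_of_forall_pow [Finite σ] {G : Ideal (MvPolynomial σ ℝ)}
    {f : MvPolynomial σ ℝ} (hf : ∀ k, f ∈ G ⊔ idealOfVars σ ℝ ^ k) : f ∈ localIdeal G := by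
  have h : Ideal.Quotient.mk G f ∈ (⨅ i : ℕ, idealOfVars σ ℝ ^ i • ⊤ :
      Submodule (MvPolynomial σ ℝ) (MvPolynomial σ ℝ ⧸ G)) := by
    rw [Submodule.mem_iInf]
    intro k
    obtain ⟨g, hg, q, hq, rfl⟩ := Submodule.mem_sup.mp (hf k)
    have : Ideal.Quotient.mk G (g + q) = q • (1 : MvPolynomial σ ℝ ⧸ G) := by
      rw [map_add, Ideal.Quotient.eq_zero_iff_mem.mpr hg, zero_add]
      change _ = Ideal.Quotient.mk G (q * 1)
      rw [mul_one]
    rw [this]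
    exact Submodule.smul_mem_smul hq Submodule.mem_top
  obtain ⟨⟨r, hr⟩, hrf⟩ := (Ideal.mem_iInf_smul_pow_eq_bot_iff _ _).mp h
  refine ⟨1 - r, by simp [(mem_idealOfVars_iff r).mp hr], ?_⟩
  rw [← Ideal.Quotient.eq_zero_iff_mem, sub_mul, one_mul, map_sub, sub_eq_zero, map_mul]
  exact hrf.symm

end Order

/-! ### Local parametrization of the real zeros and leading forms along it -/

section Analytic

variable {σ ι κ : Type*} [Fintype σ] [Fintype ι] [Fintype κ]

theorem hasStrictFDerivAt_eval_zero (p : MvPolynomial σ ℝ) :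
    HasStrictFDerivAt (fun x => eval x p)
      (∑ i, linearPart σ p i • ContinuousLinearMap.proj (R := ℝ) (φ := fun _ : σ => ℝ) i) 0 := by
  classical
  induction p using MvPolynomial.induction_on with
  | C a => simpa [linearPart_C] using hasStrictFDerivAt_const a (0 : σ → ℝ)
  | add p q hp hq => simpa [add_smul, Finset.sum_add_distrib] using hp.fun_add hq
  | mul_X p i hp =>
    have h := hp.fun_mul (hasStrictFDerivAt_apply (𝕜 := ℝ) i (0 : σ → ℝ))
    simpa [linearPart_mul, linearPart_X, Pi.single_apply, constantCoeff_eq,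
      eval_zero] using h

theorem isBigO_eval_of_mem_pow (k : ℕ) {p : MvPolynomial σ ℝ} (hp : p ∈ idealOfVars σ ℝ ^ k) :
    (fun x => eval x p) =O[𝓝 0] fun x : σ → ℝ => ‖x‖ ^ k := by
  induction k generalizing p with
  | zero =>
    simpa using (MvPolynomial.continuous_eval p).continuousAt.isBigO_one ℝ
  | succ k ih =>
    rw [pow_succ] at hp
    refine Submodule.mul_induction_on hp (fun a ha x hx => ?_) fun a b ha hb => ?_
    · have h0 : eval (0 : σ → ℝ) x = 0 := by
        simpa [constantCoeff_eq, eval_zero] using (mem_idealOfVars_iff x).mp hx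
      have h := (hasStrictFDerivAt_eval_zero x).hasFDerivAt.isBigO_sub
      simp only [h0, sub_zero] at h
      simpa [pow_succ] using (ih ha).mul h.norm_right
    · simpa using ha.add hb

/-- A right inverse, near the origin, of a polynomial map whose linear parts form a basis. -/
theorem exists_local_parametrization (F : ι ⊕ κ → MvPolynomial σ ℝ)
    (hF : ∀ j, constantCoeff (F j) = 0) (b : Module.Basis (ι ⊕ κ) ℝ (σ → ℝ))
    (hb : ∀ j, b j = linearPart σ (F j)) :
    ∃ u : (ι → ℝ) → σ → ℝ, Tendsto u (𝓝 0) (𝓝 0) ∧ (u =O[𝓝 0] fun z => z) ∧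
      ∀ᶠ z in 𝓝 0, (∀ i, eval (u z) (F (Sum.inl i)) = z i) ∧
        ∀ j, eval (u z) (F (Sum.inr j)) = 0 := by
  classical
  let Φ : (σ → ℝ) → ι ⊕ κ → ℝ := fun x j => eval x (F j)
  let D : (σ → ℝ) →L[ℝ] (ι ⊕ κ → ℝ) := ContinuousLinearMap.pi fun j =>
    ∑ i, linearPart σ (F j) i • ContinuousLinearMap.proj (R := ℝ) (φ := fun _ : σ => ℝ) i
  have hD : HasStrictFDerivAt Φ D 0 :=
    hasStrictFDerivAt_pi'.mpr fun j => hasStrictFDerivAt_eval_zero (F j)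
  -- A vector killed by `D` pairs to zero with each `b j`, hence with every vector.
  have hinj : Function.Injective D.toLinearMap := by
    rw [← LinearMap.ker_eq_bot, LinearMap.ker_eq_bot']
    intro v hv
    have hall : ∀ w : σ → ℝ, ∑ i, w i * v i = 0 := fun w => by
      have h : (∑ i, v i • LinearMap.proj i : (σ → ℝ) →ₗ[ℝ] ℝ) = 0 := b.ext fun j => by
        simpa [D, hb, mul_comm] using congrFun hv j
      simpa [mul_comm] using LinearMap.congr_fun h w
    ext i
    simpa [Pi.single_apply] using hall (Pi.single i 1)
  have hdim : Module.finrank ℝ (σ → ℝ) = Module.finrank ℝ (ι ⊕ κ → ℝ) := by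
    rw [Module.finrank_eq_card_basis b, Module.finrank_fintype_fun_eq_card]
  let e : (σ → ℝ) ≃L[ℝ] (ι ⊕ κ → ℝ) :=
    (LinearMap.linearEquivOfInjective D.toLinearMap hinj hdim).toContinuousLinearEquiv
  have he : HasStrictFDerivAt Φ (e : (σ → ℝ) →L[ℝ] (ι ⊕ κ → ℝ)) 0 := by
    convert hD
    ext v
    rfl
  have hΦ0 : Φ 0 = 0 := by
    ext j
    simpa [Φ, constantCoeff_eq, eval_zero] using hF j
  -- The zeros in the `κ` slots force the equations to vanish at the preimage of `T z`.
  let T : (ι → ℝ) → ι ⊕ κ → ℝ := fun z => Sum.elim z 0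
  have hTcont : Continuous T := continuous_pi fun j => by
    rcases j with i | j
    · exact continuous_apply i
    · exact continuous_const
  have hT0 : T 0 = 0 := by
    ext j
    rcases j with i | j <;> rfl
  have hT : Tendsto T (𝓝 0) (𝓝 0) := by simpa [hT0] using hTcont.tendsto 0
  have hTO : T =O[𝓝 0] fun z => z := IsBigO.of_bound 1 <| Eventually.of_forall fun z => by
    rw [one_mul]
    refine (pi_norm_le_iff_of_nonneg (norm_nonneg z)).mpr fun j => ?_
    rcases j with i | j
    · exact norm_le_pi_norm z i
    · simp [T]
  have hg0 : he.localInverse Φ e 0 0 = 0 := by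
    simpa [hΦ0] using he.localInverse_apply_image
  have hgt : Tendsto (he.localInverse Φ e 0) (𝓝 0) (𝓝 0) := by
    simpa [hΦ0] using he.localInverse_tendsto
  refine ⟨fun z => he.localInverse Φ e 0 (T z), hgt.comp hT, ?_, ?_⟩
  · have h := he.to_localInverse.hasFDerivAt.isBigO_sub
    simp only [hΦ0, hg0, sub_zero] at h
    exact (h.comp_tendsto hT).trans hTO
  · have h := he.eventually_right_inverse
    rw [hΦ0] at h
    filter_upwards [hT.eventually h] with z hz
    exact ⟨fun i => congrFun hz (Sum.inl i), fun j => congrFun hz (Sum.inr j)⟩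

theorem IsHomogeneous.mem_idealOfVars_pow {ι : Type*} {Q : MvPolynomial ι ℝ} {k : ℕ}
    (hQ : Q.IsHomogeneous k) : Q ∈ idealOfVars ι ℝ ^ k := by
  simpa using aeval_mem_idealOfVars_pow (y := X) (by simp) hQ

/-- If `H` vanished near the origin, then on each ray `t • v` one would have `t ^ k * Q(v) = O(t ^
(k + 1))`, so `Q(v) = 0` for all `v`. -/
theorem IsHomogeneous.frequently_ne_zero {Q : MvPolynomial ι ℝ} {k : ℕ}
    (hQ : Q.IsHomogeneous k) (hQ0 : Q ≠ 0) {H : (ι → ℝ) → ℝ}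
    (hH : (fun z => H z - eval z Q) =O[𝓝 0] fun z => ‖z‖ ^ (k + 1)) :
    ∃ᶠ z in 𝓝 0, H z ≠ 0 := by
  intro hev
  simp only [ne_eq, not_not] at hev
  refine hQ0 (MvPolynomial.funext fun v => ?_)
  have h1 : (fun z => eval z Q) =O[𝓝 0] fun z => ‖z‖ ^ (k + 1) := by
    refine hH.neg_left.congr' ?_ EventuallyEq.rfl
    filter_upwards [hev] with z hz
    simp [hz]
  have ht : Tendsto (fun t : ℝ => t • v) (𝓝[>] 0) (𝓝 0) := by
    have : Tendsto (fun t : ℝ => t • v) (𝓝 0) (𝓝 ((0 : ℝ) • v)) :=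
      (continuous_id.smul continuous_const).tendsto 0
    rw [zero_smul] at this
    exact this.mono_left nhdsWithin_le_nhds
  have h2 := h1.comp_tendsto ht
  have h3 : (fun _ : ℝ => eval v Q) =O[𝓝[>] 0] fun t : ℝ => t := by
    have h4 : (fun t : ℝ => (t ^ k)⁻¹) =O[𝓝[>] 0] fun t : ℝ => (t ^ k)⁻¹ := isBigO_refl _ _
    have h5 : (fun t : ℝ => ‖t • v‖ ^ (k + 1)) =O[𝓝[>] 0] fun t : ℝ => t ^ (k + 1) := by
      refine IsBigO.of_bound (‖v‖ ^ (k + 1)) (Eventually.of_forall fun t => ?_)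
      simp [norm_smul, mul_pow, mul_comm]
    refine (h4.mul (h2.trans h5)).congr' ?_ ?_
    · filter_upwards [self_mem_nhdsWithin] with t ht
      have ht : t ≠ 0 := ne_of_gt ht
      simp only [Function.comp_apply, hQ.eval_smul]
      field_simp
    · filter_upwards [self_mem_nhdsWithin] with t ht
      have ht : t ≠ 0 := ne_of_gt ht
      rw [pow_succ, inv_mul_cancel_left₀ (pow_ne_zero k ht)]
  have h6 : Tendsto (fun _ : ℝ => eval v Q) (𝓝[>] 0) (𝓝 0) :=
    h3.trans_tendsto (tendsto_id.mono_left nhdsWithin_le_nhds)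
  simpa using tendsto_nhds_unique tendsto_const_nhds h6

theorem eventually_eval_eq_zero {σ ι κ : Type*} {g : κ → MvPolynomial σ ℝ} {u : (ι → ℝ) → σ → ℝ}
    (hu : Tendsto u (𝓝 0) (𝓝 0)) (hg : ∀ᶠ z in 𝓝 0, ∀ j, eval (u z) (g j) = 0)
    {f : MvPolynomial σ ℝ} (hf : f ∈ localIdeal (Ideal.span (Set.range g))) :
    ∀ᶠ z in 𝓝 0, eval (u z) f = 0 := by
  obtain ⟨h, hh, hhf⟩ := hf
  have hne : ∀ᶠ z in 𝓝 0, eval (u z) h ≠ 0 :=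
    (((MvPolynomial.continuous_eval h).tendsto 0).comp hu).eventually_ne
      (by simpa [eval_zero, constantCoeff_eq] using hh)
  filter_upwards [hg, hne] with z hz hhz
  have hker : Ideal.span (Set.range g) ≤ RingHom.ker (eval (u z)) := by
    rw [Ideal.span_le]
    rintro _ ⟨j, rfl⟩
    exact hz j
  have := hker hhf
  rw [RingHom.mem_ker, map_mul] at this
  exact (mul_eq_zero.mp this).resolve_left hhz

/-- Along a local parametrization of the zero set of the equations, a polynomial that is not
locally generated by them has a nonzero leading form. -/
theorem exists_leading_form (F : ι ⊕ κ → MvPolynomial σ ℝ)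
    (hF : ∀ j, constantCoeff (F j) = 0) (b : Module.Basis (ι ⊕ κ) ℝ (σ → ℝ))
    (hb : ∀ j, b j = linearPart σ (F j)) {u : (ι → ℝ) → σ → ℝ} (hu : Tendsto u (𝓝 0) (𝓝 0))
    (huO : u =O[𝓝 0] fun z => z)
    (huF : ∀ᶠ z in 𝓝 0, (∀ i, eval (u z) (F (Sum.inl i)) = z i) ∧
        ∀ j, eval (u z) (F (Sum.inr j)) = 0) {f : MvPolynomial σ ℝ}
    (hf : f ∉ localIdeal (Ideal.span (Set.range (F ∘ Sum.inr)))) :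
    ∃ (k : ℕ) (Q : MvPolynomial ι ℝ), Q.IsHomogeneous k ∧ Q ≠ 0 ∧
      (fun z => eval (u z) f - eval z Q) =O[𝓝 0] fun z => ‖z‖ ^ (k + 1) := by
  classical
  have hspan : ⊤ ≤ Submodule.span ℝ (Set.range fun j => linearPart σ (F j)) := by
    simp only [← hb]
    exact b.span_eq.ge
  set G := Ideal.span (Set.range (F ∘ Sum.inr)) with hG
  have hGu : ∀ g ∈ G, ∀ᶠ z in 𝓝 0, eval (u z) g = 0 := fun g hg =>
    eventually_eval_eq_zero hu (huF.mono fun _ hz => hz.2) (le_localIdeal _ hg)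
  have hex : ∃ k, f ∉ G ⊔ idealOfVars σ ℝ ^ k := by
    by_contra! h
    exact hf (mem_localIdeal_of_forall_pow h)
  -- The least exponent that fails is positive, since the zeroth power is the unit ideal; its
  -- predecessor `k` is the order of `f` modulo `G`.
  obtain ⟨k, hk⟩ : ∃ k, Nat.find hex = k + 1 := Nat.exists_eq_succ_of_ne_zero fun h => by
    have := Nat.find_spec hex
    rw [h] at this
    simp at this
  have hfk : f ∈ G ⊔ idealOfVars σ ℝ ^ k := by
    simpa using Nat.find_min hex (m := k) (by omega)
  have hfk1 : f ∉ G ⊔ idealOfVars σ ℝ ^ (k + 1) := hk ▸ Nat.find_spec hex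
  obtain ⟨g, hg, q, hq, rfl⟩ := Submodule.mem_sup.mp hfk
  obtain ⟨Q, hQ, hqQ⟩ := exists_isHomogeneous_sub_mem F hF hspan k hq
  refine ⟨k, Q, hQ, ?_, ?_⟩
  · rintro rfl
    rw [map_zero, sub_zero] at hqQ
    exact hfk1 (add_mem (Ideal.mem_sup_left hg) hqQ)
  obtain ⟨g', hg', r, hr, hgr⟩ := Submodule.mem_sup.mp hqQ
  have hrO := ((isBigO_eval_of_mem_pow _ hr).comp_tendsto hu).trans (huO.norm_norm.pow (k + 1))
  refine hrO.congr' ?_ EventuallyEq.rfl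
  filter_upwards [hGu g hg, hGu g' hg', huF] with z hz hz' hzF
  have hqz : eval (u z) q = eval (u z) (aeval (F ∘ Sum.inl) Q) + eval (u z) r := by
    rw [← sub_eq_iff_eq_add', ← map_sub, ← hgr, map_add, hz', zero_add]
  have hQz : eval (u z) (aeval (F ∘ Sum.inl) Q) = eval z Q := by
    have hz : (fun i => aeval (u z) ((F ∘ Sum.inl) i)) = z := _root_.funext hzF.1
    have h := congrArg (fun φ => φ Q) (comp_aeval (F ∘ Sum.inl) (aeval (u z)))
    rw [hz] at h
    exact h
  simp only [Function.comp_apply, map_add, hz, hqz, hQz]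
  ring

/-- The product of two nonzero leading forms is nonzero, whereas an element of the local ideal
vanishes along `u` near the origin. -/
theorem isPrime_localIdeal (F : ι ⊕ κ → MvPolynomial σ ℝ)
    (hF : ∀ j, constantCoeff (F j) = 0) (b : Module.Basis (ι ⊕ κ) ℝ (σ → ℝ))
    (hb : ∀ j, b j = linearPart σ (F j)) :
    (localIdeal (Ideal.span (Set.range (F ∘ Sum.inr)))).IsPrime := by
  obtain ⟨u, hu, huO, huF⟩ := exists_local_parametrization F hF b hb
  have hker : Ideal.span (Set.range (F ∘ Sum.inr)) ≤ RingHom.ker constantCoeff := by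
    rw [Ideal.span_le]
    rintro _ ⟨j, rfl⟩
    exact hF _
  refine ⟨fun h => ?_, fun {f f'} hff' => ?_⟩
  · obtain ⟨h, hh, hh1⟩ := (Ideal.eq_top_iff_one _).mp h
    exact hh (by simpa using hker hh1)
  by_contra hcon
  rw [not_or] at hcon
  obtain ⟨k, Q, hQ, hQ0, hfQ⟩ := exists_leading_form F hF b hb hu huO huF hcon.1
  obtain ⟨l, Q', hQ', hQ'0, hfQ'⟩ := exists_leading_form F hF b hb hu huO huF hcon.2
  have hQO := isBigO_eval_of_mem_pow k hQ.mem_idealOfVars_pow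
  have hQ'O := isBigO_eval_of_mem_pow l hQ'.mem_idealOfVars_pow
  have h1 : (fun z => eval (u z) (f * f') - eval z (Q * Q')) =O[𝓝 0]
      fun z : ι → ℝ => ‖z‖ ^ (k + l + 1) := by
    have hle : (fun z : ι → ℝ => ‖z‖ ^ (l + 1)) =O[𝓝 0] fun z => ‖z‖ ^ l := by
      have h : (fun z : ι → ℝ => ‖z‖) =O[𝓝 0] fun _ => (1 : ℝ) :=
        continuous_norm.continuousAt.isBigO_one ℝ
      simpa [pow_succ] using (isBigO_refl (fun z : ι → ℝ => ‖z‖ ^ l) (𝓝 0)).mul h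
    -- Along `u`, `f f' - Q Q' = (f - Q) f' + Q (f' - Q')`, with `f'` bounded as `Q' + (f' - Q')`.
    have ha := hfQ.mul (hQ'O.add (hfQ'.trans hle))
    have hb := hQO.mul hfQ'
    simp only [← pow_add] at ha hb
    refine ((ha.congr_right fun z => ?_).add (hb.congr_right fun z => ?_)).congr_left fun z => ?_
    · ring
    · ring
    · simp only [map_mul]
      ring
  refine (hQ.mul hQ').frequently_ne_zero (mul_ne_zero hQ0 hQ'0) h1 ?_
  filter_upwards [eventually_eval_eq_zero hu (huF.mono fun _ hz => hz.2) hff'] with z hz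
  exact not_not.mpr hz

/-- Near the origin, the zero set of the equations contains real points at which a given
polynomial outside the local ideal does not vanish. -/
theorem exists_eval_ne_zero (F : ι ⊕ κ → MvPolynomial σ ℝ)
    (hF : ∀ j, constantCoeff (F j) = 0) (b : Module.Basis (ι ⊕ κ) ℝ (σ → ℝ))
    (hb : ∀ j, b j = linearPart σ (F j)) {f : MvPolynomial σ ℝ}
    (hf : f ∉ localIdeal (Ideal.span (Set.range (F ∘ Sum.inr)))) :
    ∃ x : σ → ℝ, eval x f ≠ 0 ∧
      localIdeal (Ideal.span (Set.range (F ∘ Sum.inr))) ≤ RingHom.ker (eval x) := by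
  obtain ⟨u, hu, huO, huF⟩ := exists_local_parametrization F hF b hb
  obtain ⟨k, Q, hQ, hQ0, hfQ⟩ := exists_leading_form F hF b hb hu huO huF hf
  -- Finitely many generators vanish along `u` on a common neighbourhood of the origin.
  obtain ⟨s, hs⟩ := (isNoetherianRing_iff_ideal_fg _).mp inferInstance
    (localIdeal (Ideal.span (Set.range (F ∘ Sum.inr))))
  have hev : ∀ᶠ z in 𝓝 0, ∀ p ∈ s, eval (u z) p = 0 := by
    rw [Filter.eventually_all_finset]
    exact fun p hp => eventually_eval_eq_zero hu (huF.mono fun _ hz => hz.2)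
      (hs ▸ Submodule.subset_span hp)
  obtain ⟨z, hz, hzs⟩ := ((hQ.frequently_ne_zero hQ0 hfQ).and_eventually hev).exists
  refine ⟨u z, hz, ?_⟩
  rw [← hs]
  exact Submodule.span_le.mpr hzs

end Analytic

end MvPolynomial

end

/-! ### Heights, adapted coordinates and the affine case -/

section

open MvPolynomial

/-- Chains of primes pulled back from `A` stay above the nonzero kernel, so `⊥` can be put in front
of them. -/
theorem Ideal.height_add_one_le_height_comap {A B : Type*} [CommRing A] [CommRing B] [IsDomain B]
    (f : B →+* A) (hf : Function.Surjective f) (hker : RingHom.ker f ≠ ⊥) (p : Ideal A)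
    [p.IsPrime] : p.height + 1 ≤ (p.comap f).height := by
  let p' : PrimeSpectrum A := ⟨p, ‹_›⟩
  have hmono : StrictMono (PrimeSpectrum.comap f) :=
    Monotone.strictMono_of_injective (fun _ _ h => Ideal.comap_mono h)
      (PrimeSpectrum.comap_injective_of_surjective f hf)
  have h1 : p.height = Order.height p' := PrimeSpectrum.height_eq_orderHeight p'
  have h2 : (p.comap f).height = Order.height (PrimeSpectrum.comap f p') :=
    PrimeSpectrum.height_eq_orderHeight (PrimeSpectrum.comap f p')
  rw [h1, h2]
  have key : ∀ n : ℕ, (n : ℕ∞) ≤ Order.height p' →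
      ((n + 1 : ℕ) : ℕ∞) ≤ Order.height (PrimeSpectrum.comap f p') := by
    intro n hn
    obtain ⟨l, hl, rfl⟩ := Order.exists_series_of_le_height p' hn
    have hbot : (⊥ : PrimeSpectrum B) < (l.map _ hmono).head := by
      rw [bot_lt_iff_ne_bot]
      intro h
      refine hker (le_bot_iff.mp ?_)
      have h3 : (PrimeSpectrum.comap f l.head).asIdeal = ⊥ := congrArg PrimeSpectrum.asIdeal h
      rw [← h3]
      exact Ideal.comap_mono bot_le
    have h3 := Order.length_le_height (p := (l.map _ hmono).cons ⊥ hbot)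
      (x := PrimeSpectrum.comap f p') (by simp [hl])
    simpa using h3
  cases h : Order.height p' with
  | top =>
    rw [top_add, top_le_iff, ENat.eq_top_iff_forall_ge]
    exact fun n => (Nat.cast_le.mpr n.le_succ).trans (key n (h ▸ le_top))
  | coe n => exact_mod_cast key n h.ge

namespace MvPolynomial

theorem idealOfVars_isPrime (σ : Type*) : (idealOfVars σ ℝ).IsPrime := by
  have : idealOfVars σ ℝ = RingHom.ker (constantCoeff (R := ℝ) (σ := σ)) := by
    ext p
    exact mem_idealOfVars_iff p
  rw [this]
  exact RingHom.ker_isPrime _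

theorem localIdeal_le {σ : Type*} {G I : Ideal (MvPolynomial σ ℝ)} [I.IsPrime] (hGI : G ≤ I)
    (hI : I ≤ idealOfVars σ ℝ) : localIdeal G ≤ I := by
  rintro f ⟨h, hh, hhf⟩
  refine ((‹I.IsPrime›).mem_or_mem (hGI hhf)).resolve_left fun hhI => hh ?_
  exact (mem_idealOfVars_iff h).mp (hI hhI)

section

variable {σ ι κ : Type*} [Finite σ] [Fintype ι] [Fintype κ]

/-- Nakayama: modulo `q` the ideal of the origin equals its square, so it is killed by some `r`
congruent to 1 modulo it. Such an `r` is nonzero and the quotient is a domain. -/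
theorem idealOfVars_le_of_mem (F : ι ⊕ κ → MvPolynomial σ ℝ)
    (hF : ∀ j, constantCoeff (F j) = 0)
    (hspan : ⊤ ≤ Submodule.span ℝ (Set.range fun j => linearPart σ (F j)))
    {q : Ideal (MvPolynomial σ ℝ)} [q.IsPrime] (hFq : ∀ j, F j ∈ q) (hq : q ≤ idealOfVars σ ℝ) :
    idealOfVars σ ℝ ≤ q := by
  set N := (idealOfVars σ ℝ).map (Ideal.Quotient.mk q) with hN
  have hle : N ≤ N • N := by
    rw [hN, Ideal.map_le_iff_le_comap]
    intro x hx
    obtain ⟨L, hL, hxL⟩ := exists_linear_sub_mem F hF hspan hx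
    obtain ⟨g, hg, r, hr, hgr⟩ := Submodule.mem_sup.mp hxL
    have hLq : aeval (F ∘ Sum.inl) L ∈ q := by
      have hle : idealOfVars ι ℝ ≤ q.comap (aeval (F ∘ Sum.inl)) := by
        rw [Ideal.span_le]
        rintro _ ⟨i, rfl⟩
        simpa using hFq _
      exact hle (by simpa using hL.mem_idealOfVars_pow)
    have hgq : g ∈ q := by
      refine Ideal.span_le.mpr ?_ hg
      rintro _ ⟨j, rfl⟩
      exact hFq _
    have hx' : Ideal.Quotient.mk q x = Ideal.Quotient.mk q r := by
      rw [Ideal.Quotient.eq, show x - r = aeval (F ∘ Sum.inl) L + g by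
        linear_combination -hgr]
      exact add_mem hLq hgq
    rw [Ideal.mem_comap, hx', smul_eq_mul, ← Ideal.map_mul, ← pow_two]
    exact Ideal.mem_map_of_mem _ hr
  obtain ⟨r, hr1, hr⟩ := Submodule.exists_sub_one_mem_and_smul_eq_zero_of_fg_of_le_smul N N
    (IsNoetherian.noetherian N) hle
  have hr0 : r ≠ 0 := by
    rintro rfl
    rw [zero_sub, neg_mem_iff, ← map_one (Ideal.Quotient.mk q), ← Ideal.mem_comap,
      Ideal.comap_map_of_surjective' _ Ideal.Quotient.mk_surjective, Ideal.mk_ker,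
      sup_eq_left.mpr hq, mem_idealOfVars_iff] at hr1
    simp at hr1
  intro x hx
  rw [← Ideal.Quotient.eq_zero_iff_mem]
  exact (mul_eq_zero.mp (hr _ (Ideal.mem_map_of_mem _ hx))).resolve_left hr0

/-- Krull's height theorem: modulo `J`, the origin is a minimal prime over the images of the `F
(Sum.inl i)`. -/
theorem height_map_idealOfVars_le (F : ι ⊕ κ → MvPolynomial σ ℝ)
    (hF : ∀ j, constantCoeff (F j) = 0)
    (hspan : ⊤ ≤ Submodule.span ℝ (Set.range fun j => linearPart σ (F j)))
    {J : Ideal (MvPolynomial σ ℝ)} (hFJ : ∀ j, F (Sum.inr j) ∈ J) (hJ : J ≤ idealOfVars σ ℝ) :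
    ((idealOfVars σ ℝ).map (Ideal.Quotient.mk J)).height ≤ Fintype.card ι := by
  have hm := idealOfVars_isPrime σ
  have hprime : ((idealOfVars σ ℝ).map (Ideal.Quotient.mk J)).IsPrime :=
    Ideal.map_isPrime_of_surjective Ideal.Quotient.mk_surjective (by simpa using hJ)
  have hmin : (idealOfVars σ ℝ).map (Ideal.Quotient.mk J) ∈
      (Ideal.span (Set.range fun i => Ideal.Quotient.mk J (F (Sum.inl i)))).minimalPrimes := by
    refine ⟨⟨hprime, ?_⟩, ?_⟩
    · rw [Ideal.span_le]
      rintro _ ⟨i, rfl⟩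
      exact Ideal.mem_map_of_mem _ ((mem_idealOfVars_iff _).mpr (hF _))
    · rintro q ⟨hq, hyq⟩ hqm
      rw [Ideal.map_le_iff_le_comap]
      refine idealOfVars_le_of_mem F hF hspan ?_ ?_
      · rintro (i | j)
        · exact hyq (Ideal.subset_span ⟨i, rfl⟩)
        · rw [Ideal.mem_comap, Ideal.Quotient.eq_zero_iff_mem.mpr (hFJ j)]
          exact zero_mem _
      · refine (Ideal.comap_mono hqm).trans ?_
        rw [Ideal.comap_map_of_surjective' _ Ideal.Quotient.mk_surjective, Ideal.mk_ker,
          sup_eq_left.mpr hJ]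
  refine (Ideal.height_le_card_of_mem_minimalPrimes_span (Set.finite_range _) hmin).trans ?_
  rw [← Nat.card_eq_fintype_card]
  exact_mod_cast Finite.card_range_le _

end

/-- The `inr` coordinates lift a basis of the space `W` of linear parts of `I`, and `e` is the
codimension of `W`. Taking linear parts in `hX` shows that those of the `d` polynomials `a i` span
modulo `W`, whence `e ≤ d`. -/
theorem exists_adapted_coordinates {σ : Type*} [Fintype σ] {I : Ideal (MvPolynomial σ ℝ)}
    (hI : I ≤ idealOfVars σ ℝ) {d : ℕ} (a : Fin d → MvPolynomial σ ℝ)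
    (ha : ∀ i, constantCoeff (a i) = 0)
    (hX : ∀ i, ∃ h, constantCoeff h ≠ 0 ∧ h * X i ∈ Ideal.span (Set.range a) ⊔ I) :
    ∃ (e r : ℕ) (F : Fin e ⊕ Fin r → MvPolynomial σ ℝ)
      (b : Module.Basis (Fin e ⊕ Fin r) ℝ (σ → ℝ)), e ≤ d ∧ (∀ j, constantCoeff (F j) = 0) ∧
      (∀ j, b j = linearPart σ (F j)) ∧ ∀ j, F (Sum.inr j) ∈ I := by
  classical
  set W : Submodule ℝ (σ → ℝ) := (I.restrictScalars ℝ).map (linearPart σ) with hW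
  obtain ⟨W', hWW'⟩ := Submodule.exists_isCompl W
  let b : Module.Basis (Fin (Module.finrank ℝ W') ⊕ Fin (Module.finrank ℝ W)) ℝ (σ → ℝ) :=
    ((Module.finBasis ℝ W').prod (Module.finBasis ℝ W)).map
      (Submodule.prodEquivOfIsCompl W' W hWW'.symm)
  have hlift : ∀ j, ∃ p : MvPolynomial σ ℝ, constantCoeff p = 0 ∧ b j = linearPart σ p ∧
      ∀ j', j = Sum.inr j' → p ∈ I := by
    rintro (i | j)
    · refine ⟨∑ k, C (b (Sum.inl i) k) * X k, by simp, ?_, by simp⟩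
      ext k
      simp [linearPart_mul, linearPart_X, linearPart_C, Pi.single_apply]
    · obtain ⟨p, hp, hpj⟩ : b (Sum.inr j) ∈ W := by simp [b]
      exact ⟨p, (mem_idealOfVars_iff p).mp (hI hp), hpj.symm, fun _ _ => hp⟩
  choose F hF hb hFI using hlift
  refine ⟨_, _, F, b, ?_, hF, hb, fun j => hFI _ j rfl⟩
  have hspan : ∀ p ∈ Ideal.span (Set.range a),
      linearPart σ p ∈ Submodule.span ℝ (Set.range fun i => linearPart σ (a i)) := by
    intro p hp
    obtain ⟨c, rfl⟩ := (Ideal.mem_span_range_iff_exists_fun).mp hp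
    simp only [map_sum, linearPart_mul, ha, zero_smul, add_zero]
    exact Submodule.sum_mem _ fun i _ => Submodule.smul_mem _ _ (Submodule.subset_span ⟨i, rfl⟩)
  have htop : Submodule.span ℝ (Set.range fun i => linearPart σ (a i)) ⊔ W = ⊤ := by
    rw [eq_top_iff, ← (Pi.basisFun ℝ σ).span_eq, Submodule.span_le]
    rintro _ ⟨i, rfl⟩
    obtain ⟨h, hh, hhX⟩ := hX i
    obtain ⟨s, hs, t, ht, hst⟩ := Submodule.mem_sup.mp hhX
    have h1 : linearPart σ s + linearPart σ t = constantCoeff h • Pi.single i 1 := by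
      rw [← map_add, hst]
      simp [linearPart_mul, linearPart_X]
    rw [Pi.basisFun_apply, ← inv_smul_smul₀ hh (Pi.single i (1 : ℝ) : σ → ℝ), ← h1]
    exact Submodule.smul_mem _ _ (Submodule.add_mem_sup (hspan s hs) ⟨t, ht, rfl⟩)
  have h1 := Submodule.finrank_add_eq_of_isCompl hWW'
  have h2 := Submodule.finrank_add_le_finrank_add_finrank
    (Submodule.span ℝ (Set.range fun i => linearPart σ (a i))) W
  have h3 := finrank_range_le_card (R := ℝ) (fun i => linearPart σ (a i))
  rw [htop, finrank_top] at h2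
  rw [Set.finrank, Fintype.card_fin] at h3
  omega

end MvPolynomial

theorem Algebra.FiniteType.exists_centered_presentation {A : Type*} [CommRing A] [Algebra ℝ A]
    [Algebra.FiniteType ℝ A] (φ : A →ₐ[ℝ] ℝ) :
    ∃ (n : ℕ) (π : MvPolynomial (Fin n) ℝ →ₐ[ℝ] A), Function.Surjective π ∧
      ∀ p, φ (π p) = constantCoeff p := by
  obtain ⟨n, f, hf⟩ := Algebra.FiniteType.iff_quotient_mvPolynomial''.mp
    (‹_› : Algebra.FiniteType ℝ A)
  let π : MvPolynomial (Fin n) ℝ →ₐ[ℝ] A :=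
    aeval fun i => f (X i) - algebraMap ℝ A (φ (f (X i)))
  let τ : MvPolynomial (Fin n) ℝ →ₐ[ℝ] MvPolynomial (Fin n) ℝ :=
    aeval fun i => X i + C (φ (f (X i)))
  have hπτ : π.comp τ = f := by
    ext i
    simp [π, τ, ← algebraMap_eq]
  refine ⟨n, π, fun x => ?_, fun p => ?_⟩
  · obtain ⟨p, rfl⟩ := hf x
    exact ⟨τ p, congrArg (fun g => g p) hπτ⟩
  · have : (φ.comp π) = aeval (0 : Fin n → ℝ) := by
      ext i
      simp [π]
    rw [← AlgHom.comp_apply, this, aeval_zero, constantCoeff_eq]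
    simp

/-- Clear denominators in a minimal generating set of the maximal ideal. -/
theorem IsLocalization.AtPrime.exists_generators {A : Type*} [CommRing A] (p : Ideal A)
    [p.IsPrime] (S : Type*) [CommRing S] [Algebra A S] [IsLocalization.AtPrime S p]
    [IsLocalRing S] [IsNoetherianRing S] :
    ∃ a : Fin (IsLocalRing.maximalIdeal S).spanFinrank → A, (∀ i, a i ∈ p) ∧
      ∀ x ∈ p, ∃ h ∉ p, h * x ∈ Ideal.span (Set.range a) := by
  have hfg := (IsLocalRing.maximalIdeal S).fg_of_isNoetherianRing
  have hfin := Submodule.FG.finite_generators hfg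
  have : Fintype (IsLocalRing.maximalIdeal S).generators := hfin.fintype
  have hcard : Fintype.card (IsLocalRing.maximalIdeal S).generators =
      (IsLocalRing.maximalIdeal S).spanFinrank := by
    rw [← Submodule.FG.generators_ncard hfg, Set.ncard_eq_toFinset_card', Set.toFinset_card]
  let s : Fin (IsLocalRing.maximalIdeal S).spanFinrank ≃
    (IsLocalRing.maximalIdeal S).generators := (Fintype.equivFinOfCardEq hcard).symm
  have hs : Ideal.span (Set.range fun i => (s i : S)) = IsLocalRing.maximalIdeal S := by
    refine Eq.trans ?_ (IsLocalRing.maximalIdeal S).span_generators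
    change Ideal.span (Set.range (Subtype.val ∘ s)) = _
    rw [s.surjective.range_comp, Subtype.range_coe]
  choose a ha using fun i => IsLocalization.surj p.primeCompl (s i : S)
  have hmem : ∀ i, (s i : S) ∈ IsLocalRing.maximalIdeal S := fun i =>
    hs.le (Ideal.subset_span ⟨i, rfl⟩)
  refine ⟨fun i => (a i).1, fun i => ?_, fun x hx => ?_⟩
  · rw [← IsLocalization.AtPrime.to_map_mem_maximal_iff S p, ← ha i]
    exact Ideal.mul_mem_right _ _ (hmem i)
  · have hxm : algebraMap A S x ∈ (Ideal.span (Set.range fun i => (a i).1)).map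
        (algebraMap A S) := by
      have h1 : algebraMap A S x ∈ IsLocalRing.maximalIdeal S :=
        (IsLocalization.AtPrime.to_map_mem_maximal_iff S p x).mpr hx
      rw [← hs] at h1
      refine Ideal.span_le.mpr ?_ h1
      rintro _ ⟨i, rfl⟩
      have hu := IsLocalization.map_units S (a i).2
      rw [SetLike.mem_coe, ← Ideal.mul_unit_mem_iff_mem _ hu, ha i]
      exact Ideal.mem_map_of_mem _ (Ideal.subset_span ⟨i, rfl⟩)
    obtain ⟨h, hh, hhx⟩ :=
      (IsLocalization.algebraMap_mem_map_algebraMap_iff p.primeCompl S _ x).mp hxm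
    exact ⟨h, hh, hhx⟩

/-- The real points of an integral affine variety with a regular real point are dense. -/
theorem exists_algHom_apply_ne_zero {A S : Type*} [CommRing A] [IsDomain A] [Algebra ℝ A]
    [Algebra.FiniteType ℝ A] (φ : A →ₐ[ℝ] ℝ) (m : Ideal A) [m.IsPrime]
    (hm : m = RingHom.ker φ) [CommRing S] [Algebra A S] [IsLocalization.AtPrime S m]
    [IsRegularLocalRing S] {f : A} (hf : f ≠ 0) : ∃ ψ : A →ₐ[ℝ] ℝ, ψ f ≠ 0 := by
  subst hm
  obtain ⟨n, π, hπ, hφπ⟩ := Algebra.FiniteType.exists_centered_presentation φ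
  set I := RingHom.ker π with hI
  have hIm : I ≤ idealOfVars (Fin n) ℝ := fun p hp => by
    rw [mem_idealOfVars_iff, ← hφπ, show π p = 0 from hp, map_zero]
  have hcomap : (RingHom.ker φ).comap π = idealOfVars (Fin n) ℝ := by
    ext p
    rw [mem_idealOfVars_iff, ← hφπ]
    rfl
  set d := (IsLocalRing.maximalIdeal S).spanFinrank with hd
  obtain ⟨a, ha, hX⟩ : ∃ a : Fin d → MvPolynomial (Fin n) ℝ, (∀ i, constantCoeff (a i) = 0) ∧
      ∀ i, ∃ h, constantCoeff h ≠ 0 ∧ h * X i ∈ Ideal.span (Set.range a) ⊔ I := by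
    obtain ⟨a, ha, haX⟩ := IsLocalization.AtPrime.exists_generators (RingHom.ker φ) S
    choose a' ha' using fun i => hπ (a i)
    refine ⟨a', fun i => ?_, fun i => ?_⟩
    · rw [← hφπ, ha']
      exact ha i
    · obtain ⟨h, hh, hhX⟩ := haX (π (X i)) (by
        rw [RingHom.mem_ker, hφπ, constantCoeff_X])
      obtain ⟨h, rfl⟩ := hπ h
      refine ⟨h, by simpa [hφπ] using hh, ?_⟩
      rw [hI, ← Ideal.comap_map_of_surjective' _ hπ, Ideal.mem_comap, map_mul, Ideal.map_span,
        ← Set.range_comp, show π ∘ a' = a from _root_.funext ha']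
      exact hhX
  obtain ⟨e, r, F, b, hed, hF, hb, hFI⟩ := exists_adapted_coordinates hIm a ha hX
  set J := localIdeal (Ideal.span (Set.range (F ∘ Sum.inr))) with hJ
  have hIprime : I.IsPrime := RingHom.ker_isPrime _
  have hJprime : J.IsPrime := isPrime_localIdeal F hF b hb
  have hJI : J ≤ I := by
    refine localIdeal_le (Ideal.span_le.mpr ?_) hIm
    rintro _ ⟨j, rfl⟩
    exact hFI j
  have hspan : ⊤ ≤ Submodule.span ℝ (Set.range fun j => linearPart (Fin n) (F j)) := by
    simp only [← hb]
    exact b.span_eq.ge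
  -- If `J < I`, passing from `A` to the quotient by `J` raises the height `d` of the point by at
  -- least one, beyond the bound `e ≤ d`.
  have hIJ : I = J := by
    by_contra hne
    let g : (MvPolynomial (Fin n) ℝ ⧸ J) →+* A := Ideal.Quotient.lift J (π : MvPolynomial (Fin n) ℝ →+* A) fun q hq => hJI hq
    have hg : Function.Surjective g := Ideal.Quotient.lift_surjective_of_surjective _ _ hπ
    have hker : RingHom.ker g ≠ ⊥ := fun h => hne (le_antisymm (fun p hp => by
      have : Ideal.Quotient.mk J p ∈ RingHom.ker g := hp
      rw [h] at this
      exact Ideal.Quotient.eq_zero_iff_mem.mp this) hJI)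
    have h1 := Ideal.height_add_one_le_height_comap g hg hker (RingHom.ker φ)
    have h2 : (RingHom.ker φ).comap g =
        (idealOfVars (Fin n) ℝ).map (Ideal.Quotient.mk J) := by
      rw [← hcomap]
      refine (Ideal.map_comap_of_surjective _ Ideal.Quotient.mk_surjective _).symm.trans ?_
      rfl
    have h3 := height_map_idealOfVars_le F hF hspan (J := J)
      (fun j => le_localIdeal _ (Ideal.subset_span ⟨j, rfl⟩)) (hJI.trans hIm)
    have h4 : ((d : ℕ∞) : WithBot ℕ∞) = (RingHom.ker φ).height := by
      rw [← IsLocalization.AtPrime.ringKrullDim_eq_height (RingHom.ker φ) S]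
      exact IsRegularLocalRing.spanFinrank_maximalIdeal
    rw [WithBot.coe_inj] at h4
    rw [h2, ← h4] at h1
    have h5 := h1.trans h3
    rw [Fintype.card_fin] at h5
    have h6 : d + 1 ≤ e := by exact_mod_cast h5
    omega
  obtain ⟨p, rfl⟩ := hπ f
  have hp : p ∉ J := fun h => hf (by
    rw [← hIJ] at h
    exact h)
  obtain ⟨x, hx, hJx⟩ := exists_eval_ne_zero F hF b hb hp
  let e := Ideal.quotientKerAlgEquivOfSurjective hπ
  refine ⟨(Ideal.Quotient.liftₐ I (aeval x) fun q hq => hJx (hIJ.le hq)).comp e.symm.toAlgHom, ?_⟩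
  have he : e.symm (π p) = Ideal.Quotient.mk I p := e.symm_apply_eq.mpr rfl
  change Ideal.Quotient.liftₐ I (aeval x) (fun q hq => hJx (hIJ.le hq)) (e.symm (π p)) ≠ 0
  rw [he]
  exact hx

end

/-! ### From the scheme to an affine chart -/

theorem mainTheorem9 (X : Scheme.{0}) (p : X ⟶ Spec (CommRingCat.of ℝ))
    [RealVariety.IsRealVariety p] [IrreducibleSpace X]
    (hS : (RealVariety.realPoints p (RealVariety.Sm X)).Nonempty) :
    RealVariety.realClosure p = Set.univ := by
  obtain ⟨x, hxS, ⟨f, hf⟩, hfx⟩ := hS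
  let c : ↥(Spec (CommRingCat.of ℝ)) := IsLocalRing.closedPoint ℝ
  have hfx : f c = x := hfx
  have : IsReduced X := RealVariety.IsRealVariety.isReduced p
  have : LocallyOfFiniteType p := RealVariety.IsRealVariety.locallyOfFiniteType
  have : IsIntegral X := isIntegral_of_irreducibleSpace_of_isReduced X
  rw [RealVariety.realClosure, ← dense_iff_closure_eq, dense_iff_inter_open]
  intro U hU hUne
  obtain ⟨V, hV, hxV, -⟩ := exists_isAffineOpen_mem_and_subset (X := X) (x := x) (U := ⊤) trivial
  have : Nonempty V := ⟨⟨x, hxV⟩⟩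
  let ρ : CommRingCat.of ℝ ⟶ Γ(X, V) := Spec.preimage (hV.fromSpec ≫ p)
  have hρ : Spec.map ρ = hV.fromSpec ≫ p := Spec.map_preimage _
  have hft : ρ.hom.FiniteType := by
    rw [← HasRingHomProperty.Spec_iff (P := @LocallyOfFiniteType), hρ]
    infer_instance
  let : Algebra ℝ Γ(X, V) := ρ.hom.toAlgebra
  have : Algebra.FiniteType ℝ Γ(X, V) := hft
  have hrange : Set.range f ⊆ Set.range hV.fromSpec := by
    rintro _ ⟨y, rfl⟩
    rw [hV.range_fromSpec, show y = c from Subsingleton.elim (α := PrimeSpectrum ℝ) y c, hfx]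
    exact hxV
  let φ' : Γ(X, V) ⟶ CommRingCat.of ℝ := Spec.preimage (IsOpenImmersion.lift hV.fromSpec f hrange)
  have hφ' : Spec.map φ' ≫ hV.fromSpec = f := by
    rw [Spec.map_preimage, IsOpenImmersion.lift_fac]
  have hρφ : ρ ≫ φ' = 𝟙 _ := by
    apply Spec.map_injective
    rw [Spec.map_comp, hρ, ← Category.assoc, hφ', hf, Spec.map_id]
  let φ : Γ(X, V) →ₐ[ℝ] ℝ :=
    { φ'.hom with commutes' := fun r => congrArg (fun g => g.hom r) hρφ }
  have hker : (hV.primeIdealOf ⟨x, hxV⟩).asIdeal = RingHom.ker φ := by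
    have h : hV.primeIdealOf ⟨x, hxV⟩ = Spec.map φ' c := by
      apply hV.fromSpec.isOpenEmbedding.injective
      rw [hV.fromSpec_primeIdealOf, ← Scheme.Hom.comp_apply, hφ']
      exact hfx.symm
    rw [h]
    ext a
    change φ'.hom a ∈ IsLocalRing.maximalIdeal ℝ ↔ φ'.hom a = 0
    simp [IsLocalRing.maximalIdeal_eq_bot]
  let : Algebra Γ(X, V) (X.presheaf.stalk x) :=
    TopCat.Presheaf.algebra_section_stalk X.presheaf (⟨x, hxV⟩ : V)
  have : IsLocalization.AtPrime (X.presheaf.stalk x) (hV.primeIdealOf ⟨x, hxV⟩).asIdeal :=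
    hV.isLocalization_stalk ⟨x, hxV⟩
  have : IsNoetherianRing Γ(X, V) := Algebra.FiniteType.isNoetherianRing ℝ _
  have : IsNoetherianRing (X.presheaf.stalk x) := IsLocalization.isNoetherianRing
    (hV.primeIdealOf ⟨x, hxV⟩).asIdeal.primeCompl _ inferInstance
  -- A space and its dual have the same `finrank`, so membership in `Sm X` is regularity of the
  -- stalk.
  have : IsRegularLocalRing (X.presheaf.stalk x) := by
    rw [IsRegularLocalRing.iff_finrank_cotangentSpace, ← Subspace.dual_finrank_eq]
    exact hxS.symm
  -- By irreducibility `U` meets the chart `V`, hence contains a nonempty basic open set of it; a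
  -- real point where its function `g` is nonzero lies in `U`.
  obtain ⟨y, hyV, hyU⟩ := nonempty_preirreducible_inter V.isOpen hU ⟨x, hxV⟩ hUne
  obtain ⟨y, rfl⟩ := hV.range_fromSpec.ge hyV
  obtain ⟨_, ⟨g, rfl⟩, hyg, hgU⟩ :=
    PrimeSpectrum.isTopologicalBasis_basic_opens.exists_subset_of_mem_open
      hyU (hU.preimage hV.fromSpec.continuous)
  have hg : g ≠ 0 := by
    rintro rfl
    exact hyg (zero_mem _)
  obtain ⟨ψ, hψ⟩ := exists_algHom_apply_ne_zero φ _ hker (S := X.presheaf.stalk x) hg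
  let ψ' : Γ(X, V) ⟶ CommRingCat.of ℝ := CommRingCat.ofHom ψ.toRingHom
  have hρψ : ρ ≫ ψ' = 𝟙 _ := by
    ext r
    exact ψ.commutes r
  refine ⟨hV.fromSpec (Spec.map ψ' c), hgU ?_, trivial,
    ⟨Spec.map ψ' ≫ hV.fromSpec, ?_⟩, ?_⟩
  · change ψ g ∉ IsLocalRing.maximalIdeal ℝ
    simpa [IsLocalRing.maximalIdeal_eq_bot] using hψ
  · rw [Category.assoc, ← hρ, ← Spec.map_comp, hρψ, Spec.map_id]
  · rfl
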